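/- For $n\ge 1$ and real $a$, let $D(n;a)=\sum_{d\mid n,\ d\le a}\mu(d)$. Consider the following algorithm, whose input is the factorization $n=p_1^{\alpha_1}\cdots p_r^{\alpha_r}$, $p_1<\cdots<p_r$, given as the ordered array $F$ of the pairs $(p_i,\alpha_i)$, together with a real number $a$. It computes $n'=\prod_{(p,i)\in F}p$ and returns $\mathrm{SubFactSum}(F,1,1,a,n')$, where $\mathrm{SubFactSum}(F,m,m',a,n)$ is the recursive procedure which - returns $0$ if $m>a$; otherwise returns $1$ if $F=\emptyset$; otherwise returns $0$ if $m'a\ge n$; - otherwise takes the pair $(p,i)\in F$ with $p$ maximal, sets $F'=F\setminus\{(p,i)\}$, and returns $\mathrm{SubFactSum}(F',m,pm',a,n)-\mathrm{SubFactSum}(F',mp,m',a,n)$. Count one unit of time for every arithmetic operation, comparison, array access, test for emptiness, function call and return. Then the algorithm correctly computes $D(n;a)$ for every integer $n\ge 1$ and every real $a$. Moreover, there is an absolute constant $C>0$ such that the following holds for every integer $N\ge 3$ and every real $A\ge 1$: if $A\le a(n)\le 2A$ for each integer $N<n\le 2N$, and $T(n)$ denotes the running time of the algorithm on the factorization of $n$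 and $a=a(n)$, then $$\frac1N\sum_{n=N+1}^{2N}T(n)\le C\log\log N .$$ -/

import Mathlib

/-- The divisor sum `D(n; a) = ∑_{d ∣ n, d ≤ a} μ(d)`, for real `a`. -/
noncomputable def divisorMuSum (n : ℕ) (a : ℝ) : ℤ :=
  ∑ d ∈ n.divisors.filter (fun d : ℕ => (d : ℝ) ≤ a), ArithmeticFunction.moebius d

/-- An array of pairs `(p, i)` stored in the cells `0, …, len - 1`; the other cells hold
arbitrary data. -/
structure FactorArray where
  len : ℕ
  entry : ℕ → ℕ × ℕ

/-- `F` is the factorization of `n`: it lists the pairs `(p_1, α_1), …, (p_r, α_r)` with primes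
`p_1 < … < p_r`, positive exponents, and `n = p_1 ^ α_1 ⋯ p_r ^ α_r`. -/
structure FactorArray.IsFactorizationOf (F : FactorArray) (n : ℕ) : Prop where
  prime : ∀ i < F.len, (F.entry i).1.Prime
  increasing : ∀ i < F.len, ∀ j < F.len, i < j → (F.entry i).1 < (F.entry j).1
  exponent_pos : ∀ i < F.len, 0 < (F.entry i).2
  prod_eq : ∏ i ∈ Finset.range F.len, (F.entry i).1 ^ (F.entry i).2 = n

/-- A computation that returns `val` after `time` elementary operations. -/
structure Timed (α : Type) where
  val : α
  time : ℕ

namespace Timed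

/-- Sequencing of computations adds their running times; giving a value a name is free. -/
instance : Monad Timed where
  pure x := ⟨x, 0⟩
  bind x f := ⟨(f x.val).val, x.time + (f x.val).time⟩

/-- One elementary operation with result `x`. -/
def unit {α : Type} (x : α) : Timed α := ⟨x, 1⟩

/-! The elementary operations: each arithmetic operation, each comparison, each access to a cell
of an array, each test whether an array is empty, each function call and each return takes one
unit of time. -/

/-- Overhead of entering a function (passing the arguments; arrays are passed by reference). -/
def call : Timed Unit := unit ()

/-- Test for emptiness of the remaining array; the branching follows it in the code. -/
def testEmpty : Timed Unit := unit ()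

def ret {α : Type} (x : α) : Timed α := unit x

/-- The test `x > y`. -/
noncomputable def gt (x y : ℝ) : Timed Bool := unit (decide (x > y))

/-- The test `x ≥ y`. -/
noncomputable def ge (x y : ℝ) : Timed Bool := unit (decide (x ≥ y))

def mulNat (x y : ℕ) : Timed ℕ := unit (x * y)

noncomputable def mulReal (x y : ℝ) : Timed ℝ := unit (x * y)

def subInt (x y : ℤ) : Timed ℤ := unit (x - y)

/-- The index `k` of the last of `k + 1` cells. -/
def lastIndex (len : ℕ) : Timed ℕ := unit (len - 1)

def read (F : FactorArray) (i : ℕ) : Timed (ℕ × ℕ) := unit (F.entry i)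

end Timed

/-- The recursive procedure `SubFactSum(F, m, m', a, n)`, with its running time. Here the current
list consists of the first `k` entries of `F`; as the primes are in increasing order, the entry
with maximal `p` is the last one, and removing it leaves the first `k - 1` entries.

* if `m > a`, return `0`;
* if the list is empty, return `1`;
* if `m' * a ≥ n`, return `0`;
* otherwise let `(p, i)` be the entry with maximal `p`, let `F'` be the list without it, and return
  `SubFactSum(F', m, p * m', a, n) - SubFactSum(F', m * p, m', a, n)`. -/
noncomputable def subFactSum (F : FactorArray) (k m m' : ℕ) (a : ℝ) (n : ℕ) : Timed ℤ := do
  Timed.call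
  let tooSmall ← Timed.gt m a
  if tooSmall then Timed.ret 0
  else do
    Timed.testEmpty
    match k with
    | 0 => Timed.ret 1
    | k' + 1 => do
      let b ← Timed.mulReal m' a
      let large ← Timed.ge b n
      if large then Timed.ret 0
      else do
        let last ← Timed.lastIndex (k' + 1)
        let (p, _) ← Timed.read F last
        let pm' ← Timed.mulNat p m'
        let s ← subFactSum F k' m pm' a n
        let mp ← Timed.mulNat m p
        let t ← subFactSum F k' mp m' a n
        let u ← Timed.subInt s t
        Timed.ret u

/-- The product of the primes in the first `k` entries of `F`, with the time needed to
compute it. -/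
def primeProduct (F : FactorArray) (k : ℕ) : Timed ℕ := do
  Timed.call
  Timed.testEmpty
  match k with
  | 0 => Timed.ret 1
  | k' + 1 => do
    let last ← Timed.lastIndex (k' + 1)
    let (p, _) ← Timed.read F last
    let q ← primeProduct F k'
    let r ← Timed.mulNat q p
    Timed.ret r

/-- The algorithm `FactToSumMu(F, a)`, with its running time: compute `n' = ∏_{(p, i) ∈ F} p` and
return `SubFactSum(F, 1, 1, a, n')`. -/
noncomputable def factToSumMu (F : FactorArray) (a : ℝ) : Timed ℤ := do
  Timed.call
  let n' ← primeProduct F F.len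
  let s ← subFactSum F F.len 1 1 a n'
  Timed.ret s

/-!
Both claims rest on the invariant `n' = m m' P`, where `P` is the product of the primes still in the
list. If `m' a ≥ n'`, then `a ≥ m P`, so every subset product is admitted and the alternating sum
over the subsets of a nonempty set vanishes; this gives correctness (`subFactSum_val`).

For the running time, a call that recurses has `m ≤ a < m P`. If `p` is its largest remaining prime,
then `m` is a divisor of `n` all of whose prime factors exceed `p` (it is `p`-rough), and `P` divides
the `p`-smooth part `s` of `n`. As `A ≤ a ≤ 2 A`, such an `m` satisfies `m ≤ 2 A` and `A < m s`
(`criticalDivisors`), a condition that no longer involves `a`, so it can be averaged over `n`. It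
remains to see that each prime `p` contributes `O(N / p)`; then `∑ p ≤ 2 N, 1 / p = O(log log N)`.

Fix `p` and write `n = p m t`. The condition says that the `p`-smooth part of `t` is at least about
`A / m`. The logarithm of this smooth part has mean square `O(log² p)` (`sum_smoothLog_sq_le`), so
by Chebyshev's inequality a proportion `O((log p / (log (2 A / m) + log p))²)` of the `t ≤ 2 N / (p m)`
qualifies (`card_multiples_large_smoothLog_le`). The case `m = 1` is trivial, and any other `m`
exceeds `p`, so it lies in the range where `p`-rough numbers have density `O(1 / log p)`
(`card_roughUpTo_le`). Summing over dyadic blocks of `m` then leaves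
`∑ j, log p / (j + log p)² = O(1)` (`sum_roughUpTo_weight_le`).

The prime number input is Chebyshev's bound for `ψ` and the bound `∑ q ≤ x, log q / q ≤ 2 log x`.
-/

open Finset Real

/-! ### Prime sums -/

lemma sum_Icc_filter_dvd {M : Type*} [AddCommMonoid M] {d : ℕ} (hd : 0 < d) (x : ℕ) (f : ℕ → M) :
    ∑ t ∈ Icc 1 x with d ∣ t, f t = ∑ t ∈ Icc 1 (x / d), f (d * t) := by
  symm
  refine sum_bij (fun t _ => d * t) ?_ ?_ ?_ ?_
  · intro t ht
    rw [mem_Icc] at ht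
    have h1 : d * t ≤ x := (Nat.mul_le_mul_left d ht.2).trans (Nat.mul_div_le x d)
    have h2 : 0 < d * t := Nat.mul_pos hd ht.1
    simp only [mem_filter, mem_Icc]
    exact ⟨⟨h2, h1⟩, dvd_mul_right d t⟩
  · intro a _ b _ h
    exact Nat.eq_of_mul_eq_mul_left hd h
  · intro b hb
    simp only [mem_filter, mem_Icc] at hb
    obtain ⟨⟨h1, h2⟩, c, rfl⟩ := hb
    refine ⟨c, ?_, rfl⟩
    rw [mem_Icc, Nat.le_div_iff_mul_le hd]
    exact ⟨Nat.pos_of_mul_pos_left h1, by linarith [mul_comm c d]⟩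
  · intro _ _; rfl

lemma card_Icc_filter_dvd {d : ℕ} (hd : 0 < d) (x : ℕ) :
    #{t ∈ Icc 1 x | d ∣ t} = x / d := by
  have := sum_Icc_filter_dvd hd x (fun _ => 1)
  simpa using this

lemma sum_primeFactors_comm {M : Type*} [AddCommMonoid M] (x : ℕ) (f : ℕ → ℕ → M) :
    ∑ n ∈ Icc 1 x, ∑ q ∈ n.primeFactors, f n q
      = ∑ q ∈ Nat.primesLE x, ∑ n ∈ Icc 1 x with q ∣ n, f n q := by
  refine sum_comm' fun n q => ?_
  simp only [mem_Icc, Nat.mem_primeFactors, mem_filter, Nat.mem_primesLE]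
  constructor
  · rintro ⟨⟨h1, h2⟩, h3, h4, h5⟩
    exact ⟨⟨⟨h1, h2⟩, h4⟩, (Nat.le_of_dvd h1 h4).trans h2, h3⟩
  · rintro ⟨⟨⟨h1, h2⟩, h4⟩, h5, h3⟩
    exact ⟨⟨h1, h2⟩, h3, h4, by omega⟩

lemma sum_log_primeFactors_le {n : ℕ} (hn : n ≠ 0) :
    ∑ q ∈ n.primeFactors, log q ≤ log n := by
  rw [← log_prod (fun q hq => by
    exact_mod_cast (Nat.prime_of_mem_primeFactors hq).ne_zero), ← Nat.cast_prod]
  have h : 0 < ∏ q ∈ n.primeFactors, q :=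
    prod_pos fun q hq => (Nat.prime_of_mem_primeFactors hq).pos
  apply log_le_log
  · exact_mod_cast h
  · exact_mod_cast Nat.le_of_dvd (Nat.pos_of_ne_zero hn) (Nat.prod_primeFactors_dvd n)

/-- Half of Mertens' first theorem. It compares the contribution of the primes to
`∑ n ≤ x, log n` with the trivial bound `x log x`. -/
lemma sum_log_div_primesLE_le (x : ℕ) :
    ∑ q ∈ Nat.primesLE x, log q / q ≤ 2 * log x := by
  rcases Nat.eq_zero_or_pos x with rfl | hx
  · simp [Nat.primesLE]
  have hxR : (0 : ℝ) < x := by exact_mod_cast hx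
  have h1 : ∑ n ∈ Icc 1 x, ∑ q ∈ n.primeFactors, log q ≤ x * log x := by
    calc _ ≤ ∑ n ∈ Icc 1 x, log x := by
            refine sum_le_sum fun n hn => ?_
            rw [mem_Icc] at hn
            refine (sum_log_primeFactors_le (by omega)).trans ?_
            exact log_le_log (by exact_mod_cast hn.1) (by exact_mod_cast hn.2)
      _ = _ := by simp
  have h2 : ∑ n ∈ Icc 1 x, ∑ q ∈ n.primeFactors, log q
      = ∑ q ∈ Nat.primesLE x, ((x / q : ℕ) : ℝ) * log q := by
    rw [sum_primeFactors_comm]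
    refine sum_congr rfl fun q hq => ?_
    rw [sum_const, card_Icc_filter_dvd (Nat.mem_primesLE.1 hq).2.pos, nsmul_eq_mul]
  rw [h2] at h1
  have h3 : ∑ q ∈ Nat.primesLE x, (x / 2 : ℝ) * (log q / q)
      ≤ ∑ q ∈ Nat.primesLE x, ((x / q : ℕ) : ℝ) * log q := by
    refine sum_le_sum fun q hq => ?_
    obtain ⟨hqx, hq⟩ := Nat.mem_primesLE.1 hq
    have hq0 : (0 : ℝ) < q := by exact_mod_cast hq.pos
    have hlog : 0 ≤ log q := log_natCast_nonneg q
    have h4 : (x : ℝ) ≤ 2 * q * (x / q : ℕ) := by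
      have h5 : 1 ≤ x / q := (Nat.one_le_div_iff hq.pos).2 hqx
      have h6 : x < q * (x / q) + q := by
        have := Nat.lt_mul_div_succ x hq.pos
        linarith
      have h7 : q ≤ q * (x / q) := Nat.le_mul_of_pos_right q h5
      have h8 : x ≤ 2 * q * (x / q) := by
        rw [mul_assoc]
        omega
      exact_mod_cast h8
    calc (x / 2 : ℝ) * (log q / q) = (x / (2 * q)) * log q := by field_simp
      _ ≤ _ := by
        refine mul_le_mul_of_nonneg_right ?_ hlog
        rw [div_le_iff₀ (by positivity)]
        linarith
  rw [← mul_sum] at h3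
  have h4 := h3.trans h1
  have : (x : ℝ) * (∑ q ∈ Nat.primesLE x, log q / q) ≤ x * (2 * log x) := by linarith
  exact le_of_mul_le_mul_left this hxR

/-- The primes in `(√y, y]` have reciprocal sum at most `4`. -/
lemma sum_inv_primesLE_sqrt_lt_le {y : ℕ} (hy : 2 ≤ y) :
    ∑ p ∈ Nat.primesLE y with Nat.sqrt y < p, (1 / p : ℝ) ≤ 4 := by
  have hL : 0 < log y := log_pos (by exact_mod_cast hy)
  have h1 : ∑ p ∈ Nat.primesLE y with Nat.sqrt y < p, (log y / 2) * (1 / p : ℝ)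
      ≤ ∑ p ∈ Nat.primesLE y, log p / p := by
    refine (sum_le_sum (g := fun p : ℕ => log p / p) fun p hp => ?_).trans
      (sum_le_sum_of_subset_of_nonneg (filter_subset _ _) fun p _ _ =>
        div_nonneg (log_natCast_nonneg p) (Nat.cast_nonneg p))
    obtain ⟨hp1, hp2⟩ := mem_filter.1 hp
    have h3 : y < p * p := Nat.sqrt_lt.1 hp2
    have hp0 : (0 : ℝ) < p := by exact_mod_cast (Nat.mem_primesLE.1 hp1).2.pos
    have h4 : log y ≤ log ((p : ℝ) * p) :=
      log_le_log (by exact_mod_cast (by omega : 0 < y)) (by exact_mod_cast h3.le)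
    rw [log_mul hp0.ne' hp0.ne'] at h4
    rw [mul_one_div]
    exact div_le_div_of_nonneg_right (by linarith) hp0.le
  rw [← mul_sum] at h1
  have h2 := h1.trans (sum_log_div_primesLE_le y)
  have : log y * (∑ p ∈ Nat.primesLE y with Nat.sqrt y < p, (1 / p : ℝ)) ≤ log y * 4 := by
    linarith
  exact le_of_mul_le_mul_left this hL

lemma neg_one_le_log_log_two : -1 ≤ log (log 2) := by
  rw [le_log_iff_exp_le (log_pos (by norm_num))]
  have h1 := exp_neg_one_lt_d9
  have h2 := log_two_gt_d9
  linarith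

lemma sum_inv_primesLE_le_log_log_add (y : ℕ) (hy : 2 ≤ y) :
    ∑ p ∈ Nat.primesLE y, (1 / p : ℝ) ≤ 8 * log (log y) + 12 := by
  -- Passing from `y` to `√y` costs at most `4` and lowers `log log y` by at least `log 2 > 1 / 2`.
  induction y using Nat.strong_induction_on with
  | _ y ih =>
    have hsplit := sum_filter_add_sum_filter_not (Nat.primesLE y) (fun p => Nat.sqrt y < p)
      (fun p : ℕ => (1 / p : ℝ))
    have hlow : ({p ∈ Nat.primesLE y | ¬ Nat.sqrt y < p}) = Nat.primesLE (Nat.sqrt y) := by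
      ext p
      simp only [mem_filter, Nat.mem_primesLE, not_lt]
      have := Nat.sqrt_le_self y
      constructor
      · rintro ⟨⟨_, h⟩, h'⟩; exact ⟨h', h⟩
      · rintro ⟨h', h⟩; exact ⟨⟨by omega, h⟩, h'⟩
    rw [hlow] at hsplit
    have hhigh := sum_inv_primesLE_sqrt_lt_le hy
    have hl2 := log_two_gt_d9
    have hyR : (2 : ℝ) ≤ y := by exact_mod_cast hy
    by_cases h4 : y < 4
    · have h1 : Nat.primesLE (Nat.sqrt y) = ∅ := by
        ext p
        simp only [Nat.mem_primesLE, notMem_empty, iff_false, not_and]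
        intro h hp
        have : Nat.sqrt y < 2 := Nat.sqrt_lt.2 (by omega)
        have := hp.two_le
        omega
      rw [h1, sum_empty] at hsplit
      have h2 : log (log 2) ≤ log (log y) :=
        log_le_log (by linarith) (log_le_log (by norm_num) hyR)
      have := neg_one_le_log_log_two
      linarith
    · have h1 : 2 ≤ Nat.sqrt y := Nat.le_sqrt.2 (by omega)
      have h2 := ih _ (Nat.sqrt_lt_self (by omega)) h1
      have h3 : (0 : ℝ) < Nat.sqrt y := by exact_mod_cast (by omega : 0 < Nat.sqrt y)
      have h5 : 0 < log (Nat.sqrt y) := log_pos (by exact_mod_cast h1)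
      have h6 : 2 * log (Nat.sqrt y) ≤ log y := by
        rw [two_mul, ← log_mul h3.ne' h3.ne']
        exact log_le_log (by positivity) (by exact_mod_cast Nat.sqrt_le y)
      have h7 : log 2 + log (log (Nat.sqrt y)) ≤ log (log y) := by
        rw [← log_mul (by norm_num) h5.ne']
        exact log_le_log (by positivity) h6
      linarith

lemma log_log_three_pos : 0 < log (log 3) := by
  apply log_pos
  rw [lt_log_iff_exp_lt (by norm_num)]
  have := exp_one_lt_d9
  linarith

/-- `∑ p ≤ 2 N, 1 / p = O(log log N)`, uniformly for `N ≥ 3`. -/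
lemma exists_sum_inv_primesLE_two_mul_le :
    ∃ C : ℝ, 0 < C ∧ ∀ N : ℕ, 3 ≤ N →
      1 ≤ C * log (log N) ∧ ∑ p ∈ Nat.primesLE (2 * N), (1 / p : ℝ) ≤ C * log (log N) := by
  have hc := log_log_three_pos
  refine ⟨8 + 20 / log (log 3), by positivity, fun N hN => ?_⟩
  have hN' : (3 : ℝ) ≤ N := by exact_mod_cast hN
  have hl3 : 0 < log 3 := log_pos (by norm_num)
  have hlN : log 3 ≤ log N := log_le_log (by norm_num) hN'
  have hll : log (log 3) ≤ log (log N) := log_le_log hl3 hlN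
  have h1 : 20 ≤ 20 / log (log 3) * log (log N) := by
    rw [div_mul_eq_mul_div, le_div_iff₀ hc]
    linarith
  have h2 := sum_inv_primesLE_le_log_log_add (2 * N) (by omega)
  have h3 : log ((2 * N : ℕ) : ℝ) ≤ 2 * log N := by
    push_cast
    rw [two_mul (log (N : ℝ)), ← log_mul (by positivity) (by positivity)]
    exact log_le_log (by positivity) (by nlinarith)
  have h4 : log (log ((2 * N : ℕ) : ℝ)) ≤ log 2 + log (log N) := by
    rw [← log_mul (by norm_num) (by linarith)]
    exact log_le_log (log_pos (by push_cast; linarith)) h3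
  have h5 := log_two_lt_d9
  constructor
  · nlinarith
  · nlinarith

/-! ### Rough numbers -/

/-- `m` is `y`-rough: each of its prime factors exceeds `y`. -/
def IsRough (y m : ℕ) : Prop := ∀ q : ℕ, q.Prime → q ∣ m → y < q

lemma IsRough.of_dvd {y m d : ℕ} (h : IsRough y m) (hd : d ∣ m) : IsRough y d :=
  fun q hq hqd => h q hq (hqd.trans hd)

lemma IsRough.coprime {y m s : ℕ} (h : IsRough y m) (hs : 0 < s) (hsy : s ≤ y) :
    Nat.Coprime m s :=
  Nat.Coprime.symm <| Nat.coprime_of_dvd fun q hq hqs hqm => by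
    have := h q hq hqm
    have := Nat.le_of_dvd hs hqs
    omega

lemma IsRough.lt {y m : ℕ} (h : IsRough y m) (hm : 1 < m) : y < m :=
  (h _ (Nat.minFac_prime (by omega)) (Nat.minFac_dvd m)).trans_le (Nat.minFac_le (by omega))

open Classical in
/-- The `y`-rough numbers in `[1, x]`. -/
noncomputable def roughUpTo (y x : ℕ) : Finset ℕ := {m ∈ Icc 1 x | IsRough y m}

lemma mem_roughUpTo {y x m : ℕ} : m ∈ roughUpTo y x ↔ (1 ≤ m ∧ m ≤ x) ∧ IsRough y m := by
  simp [roughUpTo]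

/-- The products `m * s` of a `y`-rough `m ≤ x` and any `s ≤ y` are distinct integers up to `x * y`,
so the reciprocal sum of the rough numbers is about `log x / log y` at most. -/
lemma sum_inv_roughUpTo_mul_log_le {x y : ℕ} (hy : 1 ≤ y) :
    (∑ m ∈ roughUpTo y x, (1 / m : ℝ)) * log y ≤ 1 + log (x * y) := by
  have hlog : log y ≤ ∑ s ∈ Icc 1 y, (1 / s : ℝ) := by
    have h1 := log_add_one_le_harmonic y
    rw [harmonic_eq_sum_Icc] at h1
    push_cast at h1
    simp only [one_div]
    refine le_trans (log_le_log (by exact_mod_cast hy) (by linarith)) h1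
  have hB : 0 ≤ ∑ m ∈ roughUpTo y x, (1 / m : ℝ) := sum_nonneg fun _ _ => by positivity
  have hinj : Set.InjOn (fun z : ℕ × ℕ => z.1 * z.2) (roughUpTo y x ×ˢ Icc 1 y : Finset _) := by
    rintro ⟨m, s⟩ h1 ⟨m', s'⟩ h2 h
    simp only [coe_product, Set.mem_prod, mem_coe, mem_roughUpTo, mem_Icc] at h1 h2
    obtain ⟨⟨⟨hm, -⟩, hr⟩, hs, hsy⟩ := h1
    obtain ⟨⟨⟨hm', -⟩, hr'⟩, hs', hsy'⟩ := h2
    dsimp only at h hm hr hs hsy hm' hr' hs' hsy'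
    have e : m = m' := by
      apply Nat.dvd_antisymm
      · exact (hr.coprime hs' hsy').dvd_of_dvd_mul_right (h ▸ dvd_mul_right m s)
      · exact (hr'.coprime hs hsy).dvd_of_dvd_mul_right (h ▸ dvd_mul_right m' s')
    subst e
    rw [Nat.eq_of_mul_eq_mul_left hm h]
  calc _ ≤ (∑ m ∈ roughUpTo y x, (1 / m : ℝ)) * ∑ s ∈ Icc 1 y, (1 / s : ℝ) := by gcongr
    _ = ∑ z ∈ roughUpTo y x ×ˢ Icc 1 y, (1 / ((z.1 * z.2 : ℕ) : ℝ)) := by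
        rw [sum_mul_sum, sum_product]
        refine sum_congr rfl fun m _ => sum_congr rfl fun s _ => ?_
        push_cast
        rw [one_div_mul_one_div]
    _ = ∑ n ∈ (roughUpTo y x ×ˢ Icc 1 y).image (fun z : ℕ × ℕ => z.1 * z.2),
          (1 / (n : ℝ)) := by
        rw [sum_image hinj]
    _ ≤ ∑ n ∈ Icc 1 (x * y), (1 / (n : ℝ)) := by
        refine sum_le_sum_of_subset_of_nonneg ?_ fun _ _ _ => by positivity
        intro n hn
        obtain ⟨⟨m, s⟩, hz, rfl⟩ := mem_image.1 hn
        rw [mem_product, mem_roughUpTo, mem_Icc] at hz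
        exact mem_Icc.2 ⟨Nat.mul_pos hz.1.1.1 hz.2.1, Nat.mul_le_mul hz.1.1.2 hz.2.2⟩
    _ ≤ 1 + log (x * y) := by
        have h1 := harmonic_le_one_add_log (x * y)
        rw [harmonic_eq_sum_Icc] at h1
        push_cast at h1
        simpa only [one_div] using h1

/-- The logarithmic mass of the rough numbers, by `log = Λ * 1` and Chebyshev's bound for `ψ`. -/
lemma sum_log_roughUpTo_le (x y : ℕ) :
    ∑ m ∈ roughUpTo y x, log m ≤ (log 4 + 4) * x * ∑ m ∈ roughUpTo y x, (1 / m : ℝ) := by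
  calc ∑ m ∈ roughUpTo y x, log m
      = ∑ m ∈ roughUpTo y x, ∑ z ∈ m.divisorsAntidiagonal,
          ArithmeticFunction.vonMangoldt z.2 := by
        refine sum_congr rfl fun m _ => ?_
        rw [← ArithmeticFunction.vonMangoldt_sum,
          Nat.sum_divisorsAntidiagonal' (fun _ d => ArithmeticFunction.vonMangoldt d)]
    _ = ∑ w ∈ (roughUpTo y x).sigma (fun m => m.divisorsAntidiagonal),
          ArithmeticFunction.vonMangoldt w.2.2 := by rw [sum_sigma]
    _ ≤ ∑ w ∈ (roughUpTo y x).sigma (fun b => Ioc 0 ⌊(x / b : ℝ)⌋₊),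
          ArithmeticFunction.vonMangoldt w.2 := by
        have hinj : Set.InjOn (fun w : (_ : ℕ) × ℕ × ℕ => (⟨w.2.1, w.2.2⟩ : (_ : ℕ) × ℕ))
            ((roughUpTo y x).sigma (fun m => m.divisorsAntidiagonal) : Finset _) := by
          rintro ⟨m, b, d⟩ h1 ⟨m', b', d'⟩ h2 h
          simp only [mem_coe, mem_sigma, Nat.mem_divisorsAntidiagonal] at h1 h2
          simp only [Sigma.mk.injEq, heq_eq_eq] at h
          obtain ⟨rfl, rfl⟩ := h
          have : m = m' := h1.2.1.symm.trans h2.2.1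
          rw [this]
        rw [← sum_image (f := fun w : (_ : ℕ) × ℕ => ArithmeticFunction.vonMangoldt w.2) hinj]
        refine sum_le_sum_of_subset_of_nonneg ?_ fun _ _ _ =>
          ArithmeticFunction.vonMangoldt_nonneg
        intro w hw
        obtain ⟨⟨m, b, d⟩, h1, rfl⟩ := mem_image.1 hw
        simp only [mem_sigma, Nat.mem_divisorsAntidiagonal, mem_roughUpTo, mem_Ioc] at h1 ⊢
        obtain ⟨⟨⟨hm, hmx⟩, hr⟩, rfl, -⟩ := h1
        have hb : 0 < b := Nat.pos_of_mul_pos_right hm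
        have hd : 0 < d := Nat.pos_of_mul_pos_left hm
        refine ⟨⟨⟨hb, (Nat.le_mul_of_pos_right b hd).trans hmx⟩, hr.of_dvd (dvd_mul_right b d)⟩,
          hd, ?_⟩
        rw [Nat.floor_div_natCast, Nat.floor_natCast, Nat.le_div_iff_mul_le hb, mul_comm]
        exact hmx
    _ ≤ ∑ b ∈ roughUpTo y x, (log 4 + 4) * (x / b : ℝ) := by
        rw [sum_sigma]
        exact sum_le_sum fun b _ => Chebyshev.psi_le_const_mul_self (by positivity)
    _ = _ := by
        rw [mul_sum]
        exact sum_congr rfl fun b _ => by ring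

/-- A sieve upper bound for rough numbers: weigh each `m ≤ x` by
`log x = log m + log (x / m)`. -/
lemma card_roughUpTo_le {x y : ℕ} (hy : 2 ≤ y) (hx : y ≤ x) :
    (#(roughUpTo y x) : ℝ) ≤ 28 * x / log y := by
  have hxR : (0 : ℝ) < x := by exact_mod_cast (by omega : 0 < x)
  have hyR : (0 : ℝ) < y := by exact_mod_cast (by omega : 0 < y)
  have hLy : 0 < log y := log_pos (by exact_mod_cast hy)
  have hyx : log y ≤ log x := log_le_log hyR (by exact_mod_cast hx)
  have hl2 : log 2 ≤ log y := log_le_log (by norm_num) (by exact_mod_cast hy)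
  have hl := log_two_gt_d9
  have hl' := log_two_lt_d9
  have h4 : log 4 = 2 * log 2 := by
    rw [show (4 : ℝ) = 2 ^ 2 by norm_num, log_pow]; norm_num
  set B := ∑ m ∈ roughUpTo y x, (1 / m : ℝ) with hB
  have hB0 : 0 ≤ B := sum_nonneg fun _ _ => by positivity
  have h1 : B * log y ≤ 4 * log x := by
    have := sum_inv_roughUpTo_mul_log_le (x := x) (y := y) (by omega)
    rw [log_mul hxR.ne' hyR.ne'] at this
    linarith
  have h2 : #(roughUpTo y x) * log x ≤ 7 * x * B := by
    calc #(roughUpTo y x) * log x = ∑ m ∈ roughUpTo y x, log x := by simp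
      _ ≤ ∑ m ∈ roughUpTo y x, (log m + x * (1 / m : ℝ)) := by
        refine sum_le_sum fun m hm => ?_
        have hm0 : (0 : ℝ) < m := by exact_mod_cast (mem_roughUpTo.1 hm).1.1
        have h3 : log (x / m) ≤ x / m - 1 := log_le_sub_one_of_pos (by positivity)
        rw [log_div hxR.ne' hm0.ne'] at h3
        rw [mul_one_div]
        linarith
      _ ≤ (log 4 + 4) * x * B + x * B := by
        rw [sum_add_distrib, ← mul_sum]
        gcongr
        exact sum_log_roughUpTo_le x y
      _ ≤ 7 * x * B := by
        have : 0 ≤ x * B := by positivity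
        nlinarith
  rw [le_div_iff₀ hLy]
  have h3 : #(roughUpTo y x) * log y * log x ≤ 28 * x * log x := by
    calc _ = #(roughUpTo y x) * log x * log y := by ring
      _ ≤ 7 * x * B * log y := by gcongr
      _ = 7 * x * (B * log y) := by ring
      _ ≤ 7 * x * (4 * log x) := by gcongr
      _ = _ := by ring
  exact le_of_mul_le_mul_right h3 (by linarith)

/-- The telescoping comparison `∑ 1 / (j l + L)² ≤ 2 / (l L)`. -/
lemma sum_inv_sq_arith_le {l L : ℝ} (hl : 0 < l) (hL : l ≤ L) (J : ℕ) :
    ∑ j ∈ range J, (1 / (j * l + L)) ^ 2 ≤ 2 / (l * L) := by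
  have hL0 : 0 < L := hl.trans_le hL
  -- The factor `2` absorbs `(j + 1) l + L ≤ 2 (j l + L)`, which uses `l ≤ L`.
  have key : ∀ j : ℕ, (1 / (j * l + L)) ^ 2
      ≤ 2 / l * (1 / (j * l + L) - 1 / ((j + 1 : ℕ) * l + L)) := by
    intro j
    have h0 : 0 < j * l + L := by positivity
    push_cast
    have h1 : 0 < (j + 1) * l + L := by positivity
    have h2 : 2 / l * (1 / (j * l + L) - 1 / ((j + 1) * l + L))
        = 2 / ((j * l + L) * ((j + 1) * l + L)) := by
      field_simp
      ring
    rw [h2, div_pow, one_pow, div_le_div_iff₀ (by positivity) (by positivity)]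
    have : 0 ≤ (j : ℝ) * l := by positivity
    nlinarith
  calc _ ≤ ∑ j ∈ range J, 2 / l * (1 / (j * l + L) - 1 / ((j + 1 : ℕ) * l + L)) :=
        sum_le_sum fun j _ => key j
    _ = 2 / l * (1 / L - 1 / (J * l + L)) := by
        rw [← mul_sum, sum_range_sub' (fun j : ℕ => 1 / ((j : ℝ) * l + L))]
        simp
    _ ≤ 2 / l * (1 / L) := by
        have : 0 ≤ 1 / (J * l + L) := by positivity
        gcongr
        linarith
    _ = _ := by field_simp

/-- The rough numbers `m ≤ X` carry bounded total mass for the weight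
`(1 / m) (log y / (log (X / m) + log y))²`: a dyadic block `(X / 2 ^ (j + 1), X / 2 ^ j]` has
reciprocal sum `O(1 / log y)` and weight `(log y / (j log 2 + log y))²`. -/
lemma sum_roughUpTo_weight_le {y M : ℕ} (hy : 2 ≤ y) {X : ℝ} (hM : M ≤ X) :
    ∑ m ∈ roughUpTo y M with 1 < m, (1 / m : ℝ) * (log y / (log (X / m) + log y)) ^ 2 ≤ 200 := by
  have hl := log_two_gt_d9
  have hl2 : log 2 ≤ log y := log_le_log (by norm_num) (by exact_mod_cast hy)
  set L := log y
  have hL : 0 < L := by linarith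
  set S := {m ∈ roughUpTo y M | 1 < m} with hS
  set j : ℕ → ℕ := fun m => Nat.log 2 ⌊X / m⌋₊ with hj
  have hjM : ∀ m ∈ S, j m ∈ range (Nat.log 2 ⌊X⌋₊ + 1) := by
    intro m hm
    rw [mem_range, Nat.lt_succ_iff]
    refine Nat.log_mono_right (Nat.floor_le_floor ?_)
    have hm1 : 1 < m := (mem_filter.1 hm).2
    exact div_le_self ((Nat.cast_nonneg M).trans hM) (by exact_mod_cast hm1.le)
  rw [← sum_fiberwise_of_maps_to hjM]
  have hblock : ∀ i ∈ range (Nat.log 2 ⌊X⌋₊ + 1),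
      ∑ m ∈ S with j m = i, (1 / m : ℝ) * (L / (log (X / m) + L)) ^ 2
        ≤ 56 * L * (1 / (i * log 2 + L)) ^ 2 := by
    intro i _
    have hmem : ∀ m ∈ S, j m = i → y < m ∧ IsRough y m ∧ (2 : ℝ) ^ i * m ≤ X ∧
        X ≤ 2 ^ (i + 1) * m := by
      intro m hm hi
      obtain ⟨h1, hm1⟩ := mem_filter.1 hm
      obtain ⟨⟨-, hmM⟩, hr⟩ := mem_roughUpTo.1 h1
      have hm0 : (0 : ℝ) < m := by exact_mod_cast (by omega : 0 < m)
      have hmX : (m : ℝ) ≤ X := le_trans (by exact_mod_cast hmM) hM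
      have hfl : ⌊X / m⌋₊ ≠ 0 := by
        refine (Nat.floor_pos.2 ?_).ne'
        rw [le_div_iff₀ hm0]
        linarith
      have hXm : 0 ≤ X / m := div_nonneg (hm0.le.trans hmX) hm0.le
      refine ⟨hr.lt hm1, hr, ?_, ?_⟩
      · have h2 : 2 ^ i ≤ ⌊X / m⌋₊ := hi ▸ Nat.pow_log_le_self 2 hfl
        rw [Nat.le_floor_iff hXm, le_div_iff₀ hm0] at h2
        exact_mod_cast h2
      · have h2 : ⌊X / m⌋₊ < 2 ^ (i + 1) := hi ▸ Nat.lt_pow_succ_log_self (by norm_num) _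
        rw [Nat.floor_lt hXm, div_lt_iff₀ hm0] at h2
        exact_mod_cast h2.le
    rcases Finset.eq_empty_or_nonempty {m ∈ S | j m = i} with he | ⟨m₀, hm₀⟩
    · rw [he, sum_empty]
      positivity
    obtain ⟨hS₀, hi₀⟩ := mem_filter.1 hm₀
    obtain ⟨hy₀, -, hX₀, -⟩ := hmem m₀ hS₀ hi₀
    have hm₀R : (0 : ℝ) < m₀ := by exact_mod_cast (by omega : 0 < m₀)
    have hX : 0 < X := lt_of_lt_of_le (by positivity) hX₀
    -- A nonempty block has `y < X / 2 ^ i`, as `card_roughUpTo_le` requires: this is where `m = 1`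
    -- has to be left out.
    have hle : ∀ m : ℕ, (2 : ℝ) ^ i * m ≤ X → m ≤ ⌊X / 2 ^ i⌋₊ := by
      intro m hm
      rw [Nat.le_floor_iff (by positivity), le_div_iff₀ (by positivity)]
      linarith
    have hcard : (#{m ∈ S | j m = i} : ℝ) ≤ 28 * (X / 2 ^ i) / L := by
      have h1 : {m ∈ S | j m = i} ⊆ roughUpTo y ⌊X / 2 ^ i⌋₊ := by
        intro m hm
        obtain ⟨hS, hi⟩ := mem_filter.1 hm
        obtain ⟨hym, hr, hXm, -⟩ := hmem m hS hi
        exact mem_roughUpTo.2 ⟨⟨by omega, hle m hXm⟩, hr⟩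
      have h2 := card_roughUpTo_le hy (hy₀.le.trans (hle m₀ hX₀))
      have h3 : (#{m ∈ S | j m = i} : ℝ) ≤ #(roughUpTo y ⌊X / 2 ^ i⌋₊) := by
        exact_mod_cast card_le_card h1
      refine (h3.trans h2).trans ?_
      have : (⌊X / 2 ^ i⌋₊ : ℝ) ≤ X / 2 ^ i := Nat.floor_le (by positivity)
      gcongr
    have hterm : ∀ m ∈ {m ∈ S | j m = i}, (1 / m : ℝ) * (L / (log (X / m) + L)) ^ 2
        ≤ 2 ^ (i + 1) / X * (L / (i * log 2 + L)) ^ 2 := by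
      intro m hm
      obtain ⟨hS, hi⟩ := mem_filter.1 hm
      obtain ⟨hym, -, hXm, hXm'⟩ := hmem m hS hi
      have hm0 : (0 : ℝ) < m := by exact_mod_cast (by omega : 0 < m)
      have h1 : i * log 2 ≤ log (X / m) := by
        rw [← log_pow]
        exact log_le_log (by positivity) ((le_div_iff₀ hm0).2 hXm)
      have h2 : (1 / m : ℝ) ≤ 2 ^ (i + 1) / X := by
        rw [div_le_div_iff₀ hm0 hX]
        linarith
      have h3 : 0 < i * log 2 + L := by positivity
      have h4 : 0 ≤ L / (log (X / m) + L) := div_nonneg hL.le (by linarith)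
      gcongr
    calc _ ≤ #{m ∈ S | j m = i} • (2 ^ (i + 1) / X * (L / (i * log 2 + L)) ^ 2) :=
          sum_le_card_nsmul _ _ _ hterm
      _ ≤ 28 * (X / 2 ^ i) / L * (2 ^ (i + 1) / X * (L / (i * log 2 + L)) ^ 2) := by
          rw [nsmul_eq_mul]
          gcongr
      _ = _ := by
          have : 0 < i * log 2 + L := by positivity
          field_simp
          ring
  refine (sum_le_sum hblock).trans ?_
  rw [← mul_sum]
  have h1 := sum_inv_sq_arith_le (l := log 2) (by linarith) hl2 (Nat.log 2 ⌊X⌋₊ + 1)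
  calc _ ≤ 56 * L * (2 / (log 2 * L)) := by gcongr
    _ = 112 / log 2 := by field_simp; norm_num
    _ ≤ 200 := by
      rw [div_le_iff₀ (by linarith)]
      linarith

/-! ### Smooth parts -/

/-- The logarithm of the `y`-smooth part of `n`, that is, of the product of the prime powers in the
factorization of `n` whose primes are at most `y`. -/
noncomputable def smoothLog (y n : ℕ) : ℝ :=
  ∑ q ∈ Nat.primesLE y, n.factorization q * log q

lemma smoothLog_mul (y : ℕ) {m n : ℕ} (hm : m ≠ 0) (hn : n ≠ 0) :
    smoothLog y (m * n) = smoothLog y m + smoothLog y n := by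
  rw [smoothLog, smoothLog, smoothLog, ← sum_add_distrib, Nat.factorization_mul hm hn]
  refine sum_congr rfl fun q _ => ?_
  rw [Finsupp.add_apply]
  push_cast
  ring

lemma smoothLog_eq_zero_of_isRough {y m : ℕ} (h : IsRough y m) : smoothLog y m = 0 := by
  refine sum_eq_zero fun q hq => ?_
  obtain ⟨hqy, hq⟩ := Nat.mem_primesLE.1 hq
  have : ¬ q ∣ m := fun hd => by
    have := h q hq hd
    omega
  rw [Nat.factorization_eq_zero_of_not_dvd this]
  simp

lemma smoothLog_prime {y q : ℕ} (hq : q.Prime) (hqy : q ≤ y) : smoothLog y q = log q := by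
  rw [smoothLog, sum_eq_single_of_mem q (Nat.mem_primesLE.2 ⟨hqy, hq⟩)]
  · simp [hq.factorization_self]
  · intro r _ hr
    simp [hq.factorization, Finsupp.single_eq_of_ne hr]

/-- Only multiples of `q` contribute; replacing `t` by `q * t` gives a recursion from `x` to `x / q`. -/
lemma sum_factorization_mul {q : ℕ} (hq : q.Prime) (x : ℕ) (f : ℕ → ℝ) :
    ∑ t ∈ Icc 1 x, t.factorization q * f t
      = ∑ t ∈ Icc 1 (x / q), (1 + t.factorization q) * f (q * t) := by
  calc _ = ∑ t ∈ Icc 1 x with q ∣ t, t.factorization q * f t := by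
        symm
        refine sum_subset (filter_subset _ _) fun t ht hnt => ?_
        have : ¬ q ∣ t := fun h => hnt (mem_filter.2 ⟨ht, h⟩)
        rw [Nat.factorization_eq_zero_of_not_dvd this]
        simp
    _ = _ := by
        rw [sum_Icc_filter_dvd hq.pos]
        refine sum_congr rfl fun t ht => ?_
        have ht0 : t ≠ 0 := by
          have := (mem_Icc.1 ht).1
          omega
        rw [Nat.factorization_mul hq.ne_zero ht0, Finsupp.add_apply, hq.factorization_self]
        push_cast
        ring

lemma sum_factorization_le {q : ℕ} (hq : q.Prime) (x : ℕ) :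
    ∑ t ∈ Icc 1 x, (t.factorization q : ℝ) ≤ 2 * x / q := by
  induction x using Nat.strong_induction_on with
  | _ x ih =>
    rcases Nat.eq_zero_or_pos x with rfl | hx
    · simp
    have h1 := sum_factorization_mul hq x (fun _ => 1)
    simp only [mul_one] at h1
    rw [h1, sum_add_distrib]
    have h2 := ih (x / q) (Nat.div_lt_self hx hq.one_lt)
    have hq2 : (2 : ℝ) ≤ q := by exact_mod_cast hq.two_le
    have h3 : ((x / q : ℕ) : ℝ) ≤ x / q := Nat.cast_div_le
    have h4 : 2 * ((x / q : ℕ) : ℝ) / q ≤ x / q := by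
      calc _ ≤ 2 * (x / q : ℝ) / 2 := by gcongr
        _ = _ := by ring
    simp only [sum_const, Nat.card_Icc, Nat.add_sub_cancel, nsmul_eq_mul, mul_one]
    calc _ ≤ (x / q + x / q : ℝ) := by linarith
      _ = _ := by ring

lemma sum_smoothLog_le (x y : ℕ) :
    ∑ t ∈ Icc 1 x, smoothLog y t ≤ 4 * log y * x := by
  simp only [smoothLog]
  rw [sum_comm]
  calc _ ≤ ∑ q ∈ Nat.primesLE y, 2 * x * (log q / q) := by
        refine sum_le_sum fun q hq => ?_
        rw [← sum_mul]
        calc _ ≤ 2 * x / q * log q :=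
              mul_le_mul_of_nonneg_right (sum_factorization_le (Nat.mem_primesLE.1 hq).2 x)
                (log_natCast_nonneg q)
          _ = _ := by ring
    _ ≤ 2 * x * (2 * log y) := by
        rw [← mul_sum]
        gcongr
        exact sum_log_div_primesLE_le y
    _ = _ := by ring

lemma sum_factorization_mul_smoothLog_le {q y : ℕ} (hq : q.Prime) (hqy : q ≤ y) (x : ℕ) :
    ∑ t ∈ Icc 1 x, t.factorization q * smoothLog y t ≤ 12 * log y * x / q := by
  induction x using Nat.strong_induction_on with
  | _ x ih =>
    rcases Nat.eq_zero_or_pos x with rfl | hx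
    · simp
    have hq2 : (2 : ℝ) ≤ q := by exact_mod_cast hq.two_le
    have hlq : 0 ≤ log q := log_natCast_nonneg q
    have hlqy : log q ≤ log y := log_le_log (by linarith) (by exact_mod_cast hqy)
    have hly : 0 ≤ log y := hlq.trans hlqy
    have h3 : ((x / q : ℕ) : ℝ) ≤ x / q := Nat.cast_div_le
    have hz : (0 : ℝ) ≤ x / q := by positivity
    set z : ℕ := x / q with hzdef
    have e : ∑ t ∈ Icc 1 x, t.factorization q * smoothLog y t
        = z * log q + ∑ t ∈ Icc 1 z, smoothLog y t
          + (∑ t ∈ Icc 1 z, (t.factorization q : ℝ)) * log q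
          + ∑ t ∈ Icc 1 z, t.factorization q * smoothLog y t := by
      rw [sum_factorization_mul hq, sum_mul]
      have : (z : ℝ) * log q = ∑ t ∈ Icc 1 z, log q := by simp
      rw [this, ← sum_add_distrib, ← sum_add_distrib, ← sum_add_distrib]
      refine sum_congr rfl fun t ht => ?_
      have ht0 : t ≠ 0 := by
        have := (mem_Icc.1 ht).1
        omega
      rw [smoothLog_mul y hq.ne_zero ht0, smoothLog_prime hq hqy]
      ring
    rw [e]
    have hhalf : ∀ c : ℝ, 0 ≤ c → c * z / q ≤ c / 2 * (x / q) := by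
      intro c hc
      calc c * z / q ≤ c * (x / q) / 2 := by gcongr
        _ = _ := by ring
    have h4 : (z : ℝ) * log q ≤ log y * (x / q) := by
      rw [mul_comm]
      gcongr
    have h5 : ∑ t ∈ Icc 1 z, smoothLog y t ≤ 4 * log y * (x / q) :=
      (sum_smoothLog_le z y).trans (by gcongr)
    have h6 : (∑ t ∈ Icc 1 z, (t.factorization q : ℝ)) * log q ≤ log y * (x / q) := by
      calc _ ≤ (2 / 2 * (x / q)) * log y :=
            mul_le_mul ((sum_factorization_le hq z).trans (hhalf 2 (by norm_num))) hlqy hlq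
              (by positivity)
        _ = _ := by ring
    have h7 := (ih z (Nat.div_lt_self hx hq.one_lt)).trans (hhalf (12 * log y) (by positivity))
    calc _ ≤ log y * (x / q) + 4 * log y * (x / q) + log y * (x / q)
          + 12 * log y / 2 * (x / q) := by gcongr
      _ = _ := by ring

/-- The logarithm of the `y`-smooth part of an integer has mean square `O(log² y)`: expand one factor
over the primes `q ≤ y`. -/
lemma sum_smoothLog_sq_le (x y : ℕ) :
    ∑ t ∈ Icc 1 x, smoothLog y t ^ 2 ≤ 24 * log y ^ 2 * x := by
  have hly : 0 ≤ log y := log_natCast_nonneg y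
  have e : ∑ t ∈ Icc 1 x, smoothLog y t ^ 2
      = ∑ q ∈ Nat.primesLE y, (∑ t ∈ Icc 1 x, t.factorization q * smoothLog y t) * log q := by
    simp only [sum_mul]
    rw [sum_comm]
    refine sum_congr rfl fun t _ => ?_
    rw [sq]
    nth_rewrite 1 [smoothLog]
    rw [sum_mul]
    exact sum_congr rfl fun q _ => by ring
  rw [e]
  calc _ ≤ ∑ q ∈ Nat.primesLE y, 12 * log y * x * (log q / q) := by
        refine sum_le_sum fun q hq => ?_
        obtain ⟨hqy, hq⟩ := Nat.mem_primesLE.1 hq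
        calc _ ≤ 12 * log y * x / q * log q :=
              mul_le_mul_of_nonneg_right (sum_factorization_mul_smoothLog_le hq hqy x)
                (log_natCast_nonneg q)
          _ = _ := by ring
    _ ≤ 12 * log y * x * (2 * log y) := by
        rw [← mul_sum]
        gcongr
        exact sum_log_div_primesLE_le y
    _ = _ := by ring

/-- For a `p`-rough `m ≤ X`, the multiples `n = p m t ≤ x` of `p m` whose `p`-smooth part is at least
`X / (2 m)`: Chebyshev's inequality for `smoothLog p t` bounds their number. -/
lemma card_multiples_large_smoothLog_le {p m x : ℕ} (hp : p.Prime) (hm : m ≠ 0)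
    (hr : IsRough p m) {X : ℝ} (hmX : m ≤ X)
    {s : Finset ℕ} (hs : ∀ n ∈ s, n ∈ Icc 1 x ∧ p ∣ n ∧ m ∣ n ∧
      log (X / m) ≤ log 2 + smoothLog p n) :
    (#s : ℝ) ≤ 66 * (x / p) * ((1 / m) * (log p / (log (X / m) + log p)) ^ 2) := by
  have hp2 : (2 : ℝ) ≤ p := by exact_mod_cast hp.two_le
  have hl2 : 0 < log 2 := log_pos (by norm_num)
  have hlp : log 2 ≤ log p := log_le_log (by norm_num) hp2
  have hm0 : (0 : ℝ) < m := by exact_mod_cast Nat.pos_of_ne_zero hm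
  have hE0 : 0 ≤ log (X / m) := log_nonneg ((one_le_div hm0).2 hmX)
  set L := log p
  have hL : 0 < L := by linarith
  set E := log (X / m) + L with hE
  have hEpos : 0 < E := by linarith
  have hpm : 0 < p * m := Nat.mul_pos hp.pos (Nat.pos_of_ne_zero hm)
  have hcop : Nat.Coprime p m := (hr.coprime hp.pos le_rfl).symm
  have h1 : (#s : ℝ) * E ^ 2 ≤ 66 * L ^ 2 * (x / (p * m) : ℝ) := by
    calc (#s : ℝ) * E ^ 2 = ∑ n ∈ s, E ^ 2 := by simp
      _ ≤ ∑ n ∈ s, (2 * L + smoothLog p n) ^ 2 := by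
          refine sum_le_sum fun n hn => ?_
          have := (hs n hn).2.2.2
          gcongr
          linarith
      _ ≤ ∑ n ∈ Icc 1 x with p * m ∣ n, (2 * L + smoothLog p n) ^ 2 := by
          refine sum_le_sum_of_subset_of_nonneg (fun n hn => ?_) fun _ _ _ => sq_nonneg _
          obtain ⟨h1, h2, h3, -⟩ := hs n hn
          exact mem_filter.2 ⟨h1, hcop.mul_dvd_of_dvd_of_dvd h2 h3⟩
      _ = ∑ t ∈ Icc 1 (x / (p * m)), (3 * L + smoothLog p t) ^ 2 := by
          rw [sum_Icc_filter_dvd hpm]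
          refine sum_congr rfl fun t ht => ?_
          have ht0 : t ≠ 0 := by
            have := (mem_Icc.1 ht).1
            omega
          rw [smoothLog_mul p hpm.ne' ht0, smoothLog_mul p hp.ne_zero hm,
            smoothLog_prime hp le_rfl, smoothLog_eq_zero_of_isRough hr]
          ring
      _ ≤ ∑ t ∈ Icc 1 (x / (p * m)), (18 * L ^ 2 + 2 * smoothLog p t ^ 2) := by
          refine sum_le_sum fun t _ => ?_
          nlinarith [sq_nonneg (3 * L - smoothLog p t)]
      _ ≤ 66 * L ^ 2 * ((x / (p * m) : ℕ) : ℝ) := by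
          have h2 : ∑ t ∈ Icc 1 (x / (p * m)), smoothLog p t ^ 2
              ≤ 24 * L ^ 2 * ((x / (p * m) : ℕ) : ℝ) := sum_smoothLog_sq_le (x / (p * m)) p
          simp only [sum_add_distrib, ← mul_sum, sum_const, Nat.card_Icc, Nat.add_sub_cancel,
            nsmul_eq_mul]
          linarith
      _ ≤ _ := by
          have : ((x / (p * m) : ℕ) : ℝ) ≤ x / ((p * m : ℕ) : ℝ) := Nat.cast_div_le
          push_cast at this
          gcongr
  calc (#s : ℝ) ≤ 66 * L ^ 2 * (x / (p * m) : ℝ) / E ^ 2 := by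
        rwa [le_div_iff₀ (by positivity)]
    _ = _ := by
        field_simp

/-! ### Critical divisors on average -/

open Classical in
/-- The `p`-rough divisors `m ≤ X` of `n` such that `m` times the `p`-smooth part of `n` is at least
`X / 2`. For `X = 2 A` and `A ≤ a ≤ 2 A`, every non-terminal call of the recursion on `n` and `a`
whose largest remaining prime is `p` gives such an `m`. -/
noncomputable def criticalDivisors (X : ℝ) (n p : ℕ) : Finset ℕ :=
  {m ∈ n.divisors | IsRough p m ∧ m ≤ X ∧ log (X / m) ≤ log 2 + smoothLog p n}

/-- On average over `n ≤ x`, the critical divisors contribute `O(1 / p)` for each prime `p`: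
`m = 1` is counted trivially, and larger `m` by `card_multiples_large_smoothLog_le`. -/
lemma sum_card_criticalDivisors_prime_le {X : ℝ} (hX : 0 ≤ X) (x : ℕ) {p : ℕ} (hp : p.Prime) :
    ∑ n ∈ Icc 1 x with p ∣ n, (#(criticalDivisors X n p) : ℝ) ≤ 13201 * (x / p) := by
  classical
  set M := min x ⌊X⌋₊ with hM
  have hMX : (M : ℝ) ≤ X :=
    le_trans (by exact_mod_cast min_le_right x ⌊X⌋₊) (Nat.floor_le hX)
  set T : ℕ → Finset ℕ := fun m => {n ∈ Icc 1 x | p ∣ n ∧ m ∣ n ∧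
    log (X / m) ≤ log 2 + smoothLog p n} with hT
  have e : ∑ n ∈ Icc 1 x with p ∣ n, (#(criticalDivisors X n p) : ℝ)
      = ∑ m ∈ roughUpTo p M, (#(T m) : ℝ) := by
    simp only [card_eq_sum_ones, Nat.cast_sum]
    refine sum_comm' fun n m => ?_
    simp only [mem_filter, mem_Icc, criticalDivisors, Nat.mem_divisors, mem_roughUpTo, hT, hM,
      le_min_iff, Nat.le_floor_iff hX]
    constructor
    · rintro ⟨⟨⟨h1, h2⟩, h3⟩, ⟨h4, h5⟩, h6, h7, h8⟩
      exact ⟨⟨⟨h1, h2⟩, h3, h4, h8⟩,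
        ⟨Nat.pos_of_dvd_of_pos h4 h1, (Nat.le_of_dvd h1 h4).trans h2, h7⟩, h6⟩
    · rintro ⟨⟨⟨h1, h2⟩, h3, h4, h8⟩, ⟨h5, h6, h7⟩, h9⟩
      exact ⟨⟨⟨h1, h2⟩, h3⟩, ⟨h4, by omega⟩, h9, h7, h8⟩
  rw [e, ← sum_filter_add_sum_filter_not (roughUpTo p M) (fun m => 1 < m)]
  have hbig : ∑ m ∈ roughUpTo p M with 1 < m, (#(T m) : ℝ) ≤ 66 * (x / p) * 200 := by
    calc _ ≤ ∑ m ∈ roughUpTo p M with 1 < m,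
          66 * (x / p) * ((1 / m : ℝ) * (log p / (log (X / m) + log p)) ^ 2) := by
          refine sum_le_sum fun m hm => ?_
          obtain ⟨⟨hm1, hmM⟩, hr⟩ := mem_roughUpTo.1 (mem_filter.1 hm).1
          exact card_multiples_large_smoothLog_le hp (by omega) hr
            (le_trans (by exact_mod_cast hmM) hMX) fun n hn => mem_filter.1 hn
      _ ≤ _ := by
          rw [← mul_sum]
          gcongr
          exact sum_roughUpTo_weight_le hp.two_le hMX
  have hone : ∑ m ∈ roughUpTo p M with ¬ 1 < m, (#(T m) : ℝ) ≤ x / p := by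
    calc _ ≤ ∑ m ∈ ({1} : Finset ℕ), (#(T m) : ℝ) := by
          refine sum_le_sum_of_subset_of_nonneg (fun m hm => ?_) fun _ _ _ => Nat.cast_nonneg _
          obtain ⟨h1, h2⟩ := mem_filter.1 hm
          have := (mem_roughUpTo.1 h1).1.1
          exact mem_singleton.2 (by omega)
      _ = (#(T 1) : ℝ) := by simp
      _ ≤ #{n ∈ Icc 1 x | p ∣ n} := by
          have : T 1 ⊆ {n ∈ Icc 1 x | p ∣ n} := fun n hn =>
            mem_filter.2 ⟨(mem_filter.1 hn).1, (mem_filter.1 hn).2.1⟩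
          exact_mod_cast card_le_card this
      _ ≤ _ := by
          rw [card_Icc_filter_dvd hp.pos]
          exact Nat.cast_div_le
  linarith

lemma sum_card_criticalDivisors_le {X : ℝ} (hX : 0 ≤ X) (x : ℕ) :
    ∑ n ∈ Icc 1 x, ∑ p ∈ n.primeFactors, (#(criticalDivisors X n p) : ℝ)
      ≤ 13201 * x * ∑ p ∈ Nat.primesLE x, (1 / p : ℝ) := by
  rw [sum_primeFactors_comm, mul_sum]
  refine sum_le_sum fun p hp => ?_
  refine (sum_card_criticalDivisors_prime_le hX x (Nat.mem_primesLE.1 hp).2).trans_eq ?_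
  ring

lemma sum_card_primeFactors_le (x : ℕ) :
    ∑ n ∈ Icc 1 x, (#n.primeFactors : ℝ) ≤ x * ∑ p ∈ Nat.primesLE x, (1 / p : ℝ) := by
  have h := sum_primeFactors_comm x (fun _ _ => (1 : ℝ))
  simp only [sum_const, nsmul_eq_mul, mul_one] at h
  rw [h, mul_sum]
  refine sum_le_sum fun p hp => ?_
  rw [card_Icc_filter_dvd (Nat.mem_primesLE.1 hp).2.pos, mul_one_div]
  exact Nat.cast_div_le

/-! ### The recursion -/

namespace Timed

@[simp] lemma val_bind {α β : Type} (x : Timed α) (f : α → Timed β) :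
    (x >>= f).val = (f x.val).val := rfl

@[simp] lemma time_bind {α β : Type} (x : Timed α) (f : α → Timed β) :
    (x >>= f).time = x.time + (f x.val).time := rfl

end Timed

lemma subFactSum_zero_val (F : FactorArray) (m m' : ℕ) (a : ℝ) (n : ℕ) :
    (subFactSum F 0 m m' a n).val = if (m : ℝ) > a then 0 else 1 := by
  rw [subFactSum]
  by_cases h : (m : ℝ) > a <;>
    simp [Timed.gt, Timed.ret, Timed.unit, h]

lemma subFactSum_zero_time (F : FactorArray) (m m' : ℕ) (a : ℝ) (n : ℕ) :
    (subFactSum F 0 m m' a n).time ≤ 6 := by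
  rw [subFactSum]
  by_cases h : (m : ℝ) > a <;>
    simp [Timed.gt, Timed.ret, Timed.unit, Timed.call, Timed.testEmpty, h]

lemma subFactSum_succ_val (F : FactorArray) (k m m' : ℕ) (a : ℝ) (n : ℕ) :
    (subFactSum F (k + 1) m m' a n).val =
      if (m : ℝ) > a then 0 else if (m' : ℝ) * a ≥ n then 0 else
        (subFactSum F k m ((F.entry k).1 * m') a n).val
          - (subFactSum F k (m * (F.entry k).1) m' a n).val := by
  rw [subFactSum]
  by_cases h : (m : ℝ) > a
  · simp [Timed.gt, Timed.ret, Timed.unit, h]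
  · by_cases h' : (m' : ℝ) * a ≥ n <;>
    simp [Timed.gt, Timed.ret, Timed.unit, Timed.mulReal, Timed.ge, Timed.lastIndex, Timed.read,
      Timed.mulNat, Timed.subInt, h, h']

lemma subFactSum_succ_time (F : FactorArray) (k m m' : ℕ) (a : ℝ) (n : ℕ) :
    (subFactSum F (k + 1) m m' a n).time ≤
      if (m : ℝ) ≤ a ∧ (m' : ℝ) * a < n then
        11 + (subFactSum F k m ((F.entry k).1 * m') a n).time
          + (subFactSum F k (m * (F.entry k).1) m' a n).time
      else 6 := by
  rw [subFactSum]
  by_cases h : (m : ℝ) ≤ a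
  · by_cases h' : (m' : ℝ) * a < n
    · simp [Timed.gt, Timed.ret, Timed.unit, Timed.mulReal, Timed.ge, Timed.lastIndex, Timed.read,
        Timed.mulNat, Timed.subInt, Timed.call, Timed.testEmpty, not_lt.2 h, not_le.2 h', h, h']
      omega
    · simp [Timed.gt, Timed.ret, Timed.unit, Timed.mulReal, Timed.ge, Timed.call,
        Timed.testEmpty, not_lt.2 h, not_lt.1 h', h, h']
  · simp [Timed.gt, Timed.ret, Timed.unit, Timed.call, h, not_le.1 h]

lemma primeProduct_val (F : FactorArray) (k : ℕ) :
    (primeProduct F k).val = ∏ i ∈ range k, (F.entry i).1 := by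
  induction k with
  | zero => simp [primeProduct, Timed.ret, Timed.unit]
  | succ k ih =>
    rw [primeProduct, prod_range_succ, ← ih]
    simp [Timed.lastIndex, Timed.read, Timed.mulNat, Timed.ret, Timed.unit]

lemma primeProduct_time (F : FactorArray) (k : ℕ) :
    (primeProduct F k).time = 6 * k + 3 := by
  induction k with
  | zero => simp [primeProduct, Timed.ret, Timed.unit, Timed.call, Timed.testEmpty]
  | succ k ih =>
    rw [primeProduct]
    simp [Timed.lastIndex, Timed.read, Timed.mulNat, Timed.ret, Timed.unit, Timed.call,
      Timed.testEmpty, ih]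
    omega

lemma factToSumMu_val (F : FactorArray) (a : ℝ) :
    (factToSumMu F a).val =
      (subFactSum F F.len 1 1 a (∏ i ∈ range F.len, (F.entry i).1)).val := by
  simp [factToSumMu, Timed.ret, Timed.unit, primeProduct_val]

lemma factToSumMu_time (F : FactorArray) (a : ℝ) :
    (factToSumMu F a).time =
      6 * F.len + 5 + (subFactSum F F.len 1 1 a (∏ i ∈ range F.len, (F.entry i).1)).time := by
  simp [factToSumMu, Timed.ret, Timed.unit, Timed.call, primeProduct_val, primeProduct_time]
  omega

/-- The second stopping rule is correct since the alternating sum over all subsets of a nonempty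
set vanishes. -/
lemma subFactSum_val (F : FactorArray) (a : ℝ) {n : ℕ} (k m m' : ℕ) (hm : 0 < m) (hm' : 0 < m')
    (hF : ∀ i < k, 0 < (F.entry i).1) (hn : n = m * m' * ∏ i ∈ range k, (F.entry i).1) :
    (subFactSum F k m m' a n).val = ∑ S ∈ (range k).powerset,
      if ((m * ∏ i ∈ S, (F.entry i).1 : ℕ) : ℝ) ≤ a then (-1) ^ #S else 0 := by
  induction k generalizing m m' with
  | zero =>
    rw [subFactSum_zero_val]
    by_cases h : (m : ℝ) ≤ a
    · simp [h]
    · simp [h, not_le.1 h]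
  | succ k ih =>
    rw [subFactSum_succ_val]
    have hP : ∀ S ∈ (range (k + 1)).powerset, 1 ≤ ∏ i ∈ S, (F.entry i).1 ∧
        ∏ i ∈ S, (F.entry i).1 ≤ ∏ i ∈ range (k + 1), (F.entry i).1 := by
      intro S hS
      have hS' := mem_powerset.1 hS
      exact ⟨prod_pos fun i hi => hF i (mem_range.1 (hS' hi)),
        prod_le_prod_of_subset_of_one_le' hS' fun i hi _ => hF i (mem_range.1 hi)⟩
    split_ifs with h1 h2
    · symm
      refine sum_eq_zero fun S hS => if_neg (not_le.2 (h1.trans_le ?_))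
      exact_mod_cast Nat.le_mul_of_pos_right m (hP S hS).1
    · rw [← sum_powerset_neg_one_pow_card_of_nonempty (x := range (k + 1)) (by simp)]
      refine sum_congr rfl fun S hS => (if_pos ?_).symm
      have h3 : (m' : ℝ) * ((m * ∏ i ∈ range (k + 1), (F.entry i).1 : ℕ) : ℝ) ≤ m' * a := by
        refine le_trans (le_of_eq ?_) h2
        rw [hn]
        push_cast
        ring
      refine le_trans ?_ (le_of_mul_le_mul_left h3 (by exact_mod_cast hm'))
      exact_mod_cast Nat.mul_le_mul_left m (hP S hS).2
    · have hk := hF k (Nat.lt_succ_self k)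
      rw [ih m _ hm (Nat.mul_pos hk hm') (fun i hi => hF i (by omega))
          (by rw [hn, prod_range_succ]; ring),
        ih _ m' (Nat.mul_pos hm hk) hm' (fun i hi => hF i (by omega))
          (by rw [hn, prod_range_succ]; ring),
        range_add_one, sum_powerset_insert notMem_range_self, sub_eq_add_neg, ← sum_neg_distrib]
      congr 1
      refine sum_congr rfl fun S hS => ?_
      have hkS : k ∉ S := fun h => notMem_range_self (mem_powerset.1 hS h)
      rw [prod_insert hkS, card_insert_of_notMem hkS, ← mul_assoc]
      split_ifs
      · ring
      · simp

open Classical in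
/-- A non-terminal call whose largest remaining prime is the `i`-th one is determined by the set `S`
of larger primes that went into `m`; the two stopping rules pin `m` to within a factor equal to
the product of the remaining primes. A terminal call costs at most `6`; in the binary recursion tree
each non-terminal call costs `11` and accounts for one further terminal call, hence `17 = 11 + 6`. -/
lemma subFactSum_time_le (F : FactorArray) (a : ℝ) {n : ℕ} (k m m' : ℕ) (hm' : 0 < m')
    (hF : ∀ i < k, 0 < (F.entry i).1) (hn : n = m * m' * ∏ i ∈ range k, (F.entry i).1) :
    (subFactSum F k m m' a n).time ≤ 6 + 17 * ∑ i ∈ range k, #{S ∈ (Ico (i + 1) k).powerset |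
      ((m * ∏ l ∈ S, (F.entry l).1 : ℕ) : ℝ) ≤ a ∧
        a < ((m * (∏ l ∈ S, (F.entry l).1) * ∏ l ∈ range (i + 1), (F.entry l).1 : ℕ) : ℝ)} := by
  induction k generalizing m m' with
  | zero => simpa using subFactSum_zero_time F m m' a n
  | succ k ih =>
    refine (subFactSum_succ_time F k m m' a n).trans ?_
    split_ifs with h
    · have hk := hF k (Nat.lt_succ_self k)
      have h1 := ih m _ (Nat.mul_pos hk hm') (fun i hi => hF i (by omega))
        (by rw [hn, prod_range_succ]; ring)
      have h2 := ih (m * (F.entry k).1) m' hm' (fun i hi => hF i (by omega))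
        (by rw [hn, prod_range_succ]; ring)
      have htop : a < ((m * ∏ l ∈ range (k + 1), (F.entry l).1 : ℕ) : ℝ) := by
        have h3 : (m' : ℝ) * a < m' * ((m * ∏ i ∈ range (k + 1), (F.entry i).1 : ℕ) : ℝ) := by
          refine lt_of_lt_of_eq h.2 ?_
          rw [hn]
          push_cast
          ring
        exact lt_of_mul_lt_mul_left h3 (Nat.cast_nonneg _)
      rw [sum_range_succ]
      have hlast : #{S ∈ (Ico (k + 1) (k + 1)).powerset |
          ((m * ∏ l ∈ S, (F.entry l).1 : ℕ) : ℝ) ≤ a ∧ a < ((m * (∏ l ∈ S, (F.entry l).1) *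
            ∏ l ∈ range (k + 1), (F.entry l).1 : ℕ) : ℝ)} = 1 := by
        rw [Ico_self, powerset_empty, filter_singleton, if_pos, card_singleton]
        simpa using ⟨h.1, by exact_mod_cast htop⟩
      rw [hlast]
      have hstep : ∀ i ∈ range k, #{S ∈ (Ico (i + 1) (k + 1)).powerset |
          ((m * ∏ l ∈ S, (F.entry l).1 : ℕ) : ℝ) ≤ a ∧ a < ((m * (∏ l ∈ S, (F.entry l).1) *
            ∏ l ∈ range (i + 1), (F.entry l).1 : ℕ) : ℝ)}
          = #{S ∈ (Ico (i + 1) k).powerset |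
              ((m * ∏ l ∈ S, (F.entry l).1 : ℕ) : ℝ) ≤ a ∧ a < ((m * (∏ l ∈ S, (F.entry l).1) *
                ∏ l ∈ range (i + 1), (F.entry l).1 : ℕ) : ℝ)}
            + #{S ∈ (Ico (i + 1) k).powerset |
              ((m * (F.entry k).1 * ∏ l ∈ S, (F.entry l).1 : ℕ) : ℝ) ≤ a ∧
                a < ((m * (F.entry k).1 * (∏ l ∈ S, (F.entry l).1) *
                  ∏ l ∈ range (i + 1), (F.entry l).1 : ℕ) : ℝ)} := by
        intro i hi
        have hik := mem_range.1 hi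
        have hins : Ico (i + 1) (k + 1) = insert k (Ico (i + 1) k) :=
          (insert_Ico_right_eq_Ico_add_one (by omega)).symm
        simp only [card_filter]
        rw [hins, sum_powerset_insert right_notMem_Ico]
        congr 1
        refine sum_congr rfl fun S hS => ?_
        have hkS : k ∉ S := fun h => right_notMem_Ico (mem_powerset.1 hS h)
        rw [prod_insert hkS, ← mul_assoc m]
      rw [sum_congr rfl hstep, sum_add_distrib]
      omega
    · omega

/-! ### Arrays that hold a factorization -/

namespace FactorArray.IsFactorizationOf

variable {F : FactorArray} {n : ℕ}

lemma ne_zero (h : F.IsFactorizationOf n) : n ≠ 0 := by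
  rw [← h.prod_eq]
  exact prod_ne_zero_iff.2 fun i hi => pow_ne_zero _ (h.prime i (mem_range.1 hi)).ne_zero

lemma injOn (h : F.IsFactorizationOf n) :
    Set.InjOn (fun i => (F.entry i).1) (range F.len : Set ℕ) := by
  intro i hi j hj hij
  have hi := mem_range.1 (mem_coe.1 hi)
  have hj := mem_range.1 (mem_coe.1 hj)
  dsimp only at hij
  rcases lt_trichotomy i j with hlt | heq | hlt
  · have := h.increasing i hi j hj hlt
    omega
  · exact heq
  · have := h.increasing j hj i hi hlt
    omega

lemma image_eq_primeFactors (h : F.IsFactorizationOf n) :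
    (range F.len).image (fun i => (F.entry i).1) = n.primeFactors := by
  ext q
  rw [mem_image, Nat.mem_primeFactors_of_ne_zero h.ne_zero]
  constructor
  · rintro ⟨i, hi, rfl⟩
    have hi' := mem_range.1 hi
    refine ⟨h.prime i hi', ?_⟩
    rw [← h.prod_eq]
    exact (dvd_pow_self _ (h.exponent_pos i hi').ne').trans (dvd_prod_of_mem _ hi)
  · rintro ⟨hq, hqn⟩
    rw [← h.prod_eq, hq.prime.dvd_finsetProd_iff] at hqn
    obtain ⟨i, hi, hqi⟩ := hqn
    exact ⟨i, hi, ((Nat.prime_dvd_prime_iff_eq hq (h.prime i (mem_range.1 hi))).1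
      (hq.dvd_of_dvd_pow hqi)).symm⟩

lemma card_primeFactors (h : F.IsFactorizationOf n) : #n.primeFactors = F.len := by
  rw [← h.image_eq_primeFactors, card_image_of_injOn h.injOn, card_range]

lemma prod_dvd (h : F.IsFactorizationOf n) {S : Finset ℕ} (hS : S ⊆ range F.len) :
    ∏ i ∈ S, (F.entry i).1 ∣ n := by
  rw [← h.prod_eq]
  refine (prod_dvd_prod_of_dvd _ (fun i => (F.entry i).1 ^ (F.entry i).2) fun i hi =>
    dvd_pow_self _ (h.exponent_pos i (mem_range.1 (hS hi))).ne').trans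
      (prod_dvd_prod_of_subset _ _ _ hS)

/-- A prime dividing the product of the primes in a set of cells sits in one of these cells. -/
lemma exists_eq_of_dvd_prod (h : F.IsFactorizationOf n) {S : Finset ℕ} (hS : S ⊆ range F.len)
    {q : ℕ} (hq : q.Prime) (hd : q ∣ ∏ i ∈ S, (F.entry i).1) : ∃ i ∈ S, (F.entry i).1 = q := by
  obtain ⟨i, hi, hqi⟩ := (hq.prime.dvd_finsetProd_iff _).1 hd
  exact ⟨i, hi, ((Nat.prime_dvd_prime_iff_eq hq (h.prime i (mem_range.1 (hS hi)))).1 hqi).symm⟩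

lemma prod_injOn (h : F.IsFactorizationOf n) :
    Set.InjOn (fun S => ∏ i ∈ S, (F.entry i).1) ((range F.len).powerset : Set (Finset ℕ)) := by
  have key : ∀ S T : Finset ℕ, S ⊆ range F.len → T ⊆ range F.len →
      ∏ i ∈ S, (F.entry i).1 = ∏ i ∈ T, (F.entry i).1 → S ⊆ T := by
    intro S T hS hT e i hi
    obtain ⟨j, hj, hji⟩ := h.exists_eq_of_dvd_prod hT (h.prime i (mem_range.1 (hS hi)))
      (e ▸ dvd_prod_of_mem (fun i => (F.entry i).1) hi)
    rwa [← h.injOn (hT hj) (hS hi) hji]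
  intro S hS T hT e
  have hS := mem_powerset.1 (mem_coe.1 hS)
  have hT := mem_powerset.1 (mem_coe.1 hT)
  exact Subset.antisymm (key S T hS hT e) (key T S hT hS e.symm)

lemma moebius_prod (h : F.IsFactorizationOf n) {S : Finset ℕ} (hS : S ⊆ range F.len) :
    ArithmeticFunction.moebius (∏ i ∈ S, (F.entry i).1) = (-1) ^ #S := by
  have hinj : Set.InjOn (fun i => (F.entry i).1) (S : Set ℕ) := h.injOn.mono (coe_subset.2 hS)
  have e : ∏ i ∈ S, (F.entry i).1 = ∏ q ∈ S.image (fun i => (F.entry i).1), q :=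
    (prod_image (f := fun q => q) hinj).symm
  have hp : ∀ q ∈ S.image (fun i => (F.entry i).1), q.Prime := by
    intro q hq
    obtain ⟨i, hi, rfl⟩ := mem_image.1 hq
    exact h.prime i (mem_range.1 (hS hi))
  rw [e, ArithmeticFunction.isMultiplicative_moebius.map_prod_of_prime _ hp,
    prod_congr rfl fun q hq => ArithmeticFunction.moebius_apply_prime (hp q hq), prod_const,
    card_image_of_injOn hinj]

/-- Only squarefree divisors contribute to `D(n; a)`, and these are the products over sets of cells. -/
lemma divisorMuSum_eq (h : F.IsFactorizationOf n) (a : ℝ) :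
    divisorMuSum n a = ∑ S ∈ (range F.len).powerset,
      if ((∏ i ∈ S, (F.entry i).1 : ℕ) : ℝ) ≤ a then (-1) ^ #S else 0 := by
  rw [divisorMuSum, sum_filter]
  have e : ∑ S ∈ (range F.len).powerset,
      (if ((∏ i ∈ S, (F.entry i).1 : ℕ) : ℝ) ≤ a then (-1 : ℤ) ^ #S else 0)
      = ∑ S ∈ (range F.len).powerset, (fun d : ℕ => if (d : ℝ) ≤ a then
          ArithmeticFunction.moebius d else 0) (∏ i ∈ S, (F.entry i).1) :=
    sum_congr rfl fun S hS => by
      dsimp only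
      rw [h.moebius_prod (mem_powerset.1 hS)]
  rw [e, ← sum_image (f := fun d : ℕ => if (d : ℝ) ≤ a then
    ArithmeticFunction.moebius d else 0) h.prod_injOn]
  symm
  refine sum_subset ?_ fun d hd hnd => ?_
  · intro d hd
    obtain ⟨S, hS, rfl⟩ := mem_image.1 hd
    exact Nat.mem_divisors.2 ⟨h.prod_dvd (mem_powerset.1 hS), h.ne_zero⟩
  · have hns : ¬ Squarefree d := by
      intro hsq
      have hdn := (Nat.mem_divisors.1 hd).1
      refine hnd (mem_image.2 ⟨{i ∈ range F.len | (F.entry i).1 ∣ d},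
        mem_powerset.2 (filter_subset _ _), ?_⟩)
      have himg : ({i ∈ range F.len | (F.entry i).1 ∣ d}).image (fun i => (F.entry i).1)
          = d.primeFactors := by
        ext q
        constructor
        · intro hq
          obtain ⟨i, hi, rfl⟩ := mem_image.1 hq
          obtain ⟨hi, hid⟩ := mem_filter.1 hi
          exact Nat.mem_primeFactors.2 ⟨h.prime i (mem_range.1 hi), hid, hsq.ne_zero⟩
        · intro hq
          have hqn := Nat.primeFactors_mono hdn h.ne_zero hq
          rw [← h.image_eq_primeFactors] at hqn
          obtain ⟨i, hi, rfl⟩ := mem_image.1 hqn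
          exact mem_image.2 ⟨i, mem_filter.2 ⟨hi, Nat.dvd_of_mem_primeFactors hq⟩, rfl⟩
      refine Eq.trans ?_ (Nat.prod_primeFactors_of_squarefree hsq)
      rw [← himg]
      refine (prod_image (f := fun q => q) (h.injOn.mono ?_)).symm
      exact coe_subset.2 (filter_subset _ _)
    rw [ArithmeticFunction.moebius_eq_zero_of_not_squarefree hns, ite_self]

/-- The product of the primes up to the `i`-th one divides the smooth part of `n` at that prime. -/
lemma log_prod_le_smoothLog (h : F.IsFactorizationOf n) {i : ℕ} (hi : i < F.len) :
    log ((∏ l ∈ range (i + 1), (F.entry l).1 : ℕ) : ℝ) ≤ smoothLog (F.entry i).1 n := by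
  have hsub : range (i + 1) ⊆ range F.len := range_subset_range.2 hi
  have hinj : Set.InjOn (fun l => (F.entry l).1) (range (i + 1) : Set ℕ) :=
    h.injOn.mono (coe_subset.2 hsub)
  rw [Nat.cast_prod, log_prod (fun l hl => by
    exact_mod_cast (h.prime l (mem_range.1 (hsub hl))).ne_zero)]
  rw [← sum_image (f := fun q : ℕ => log q) hinj, smoothLog]
  refine (sum_le_sum (g := fun q : ℕ => n.factorization q * log q) fun q hq => ?_).trans
    (sum_le_sum_of_subset_of_nonneg ?_ fun q _ _ =>
      mul_nonneg (Nat.cast_nonneg _) (log_natCast_nonneg q))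
  · obtain ⟨l, hl, rfl⟩ := mem_image.1 hq
    have h1 : (F.entry l).1 ∈ n.primeFactors := by
      rw [← h.image_eq_primeFactors]
      exact mem_image_of_mem (fun i => (F.entry i).1) (hsub hl)
    obtain ⟨hp, hd, -⟩ := Nat.mem_primeFactors.1 h1
    refine le_mul_of_one_le_left (log_natCast_nonneg _) ?_
    exact_mod_cast (hp.dvd_iff_one_le_factorization h.ne_zero).1 hd
  · intro q hq
    obtain ⟨l, hl, rfl⟩ := mem_image.1 hq
    refine Nat.mem_primesLE.2 ⟨?_, h.prime l (mem_range.1 (hsub hl))⟩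
    rcases (Nat.lt_succ_iff.1 (mem_range.1 hl)).lt_or_eq with hlt | rfl
    · exact (h.increasing l (mem_range.1 (hsub hl)) i hi hlt).le
    · exact le_rfl

/-- Each non-terminal call of the recursion yields a critical divisor: `m` itself, listed under the
largest remaining prime. -/
lemma factToSumMu_time_le (h : F.IsFactorizationOf n) {A a : ℝ} (hA : 1 ≤ A) (haA : A ≤ a)
    (haA' : a ≤ 2 * A) :
    ((factToSumMu F a).time : ℝ) ≤ 11 + 6 * #n.primeFactors
      + 17 * ∑ p ∈ n.primeFactors, (#(criticalDivisors (2 * A) n p) : ℝ) := by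
  classical
  have hpos : ∀ i < F.len, 0 < (F.entry i).1 := fun i hi => (h.prime i hi).pos
  have h1 := subFactSum_time_le F a F.len 1 1 one_pos hpos (by rw [one_mul, one_mul])
  rw [factToSumMu_time, h.card_primeFactors, ← h.image_eq_primeFactors, sum_image h.injOn]
  have h2 : ∑ i ∈ range F.len, #{S ∈ (Ico (i + 1) F.len).powerset |
      ((1 * ∏ l ∈ S, (F.entry l).1 : ℕ) : ℝ) ≤ a ∧
        a < ((1 * (∏ l ∈ S, (F.entry l).1) * ∏ l ∈ range (i + 1), (F.entry l).1 : ℕ) : ℝ)}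
      ≤ ∑ i ∈ range F.len, #(criticalDivisors (2 * A) n (F.entry i).1) := by
    refine sum_le_sum fun i hi => ?_
    have hi' := mem_range.1 hi
    have hsub : ∀ S ⊆ Ico (i + 1) F.len, S ⊆ range F.len := fun S hS l hl =>
      mem_range.2 (mem_Ico.1 (hS hl)).2
    refine card_le_card_of_injOn (fun S => ∏ l ∈ S, (F.entry l).1) ?_ ?_
    · intro S hS
      obtain ⟨hS1, hSa, haS⟩ := mem_filter.1 (mem_coe.1 hS)
      have hS2 := mem_powerset.1 hS1
      rw [one_mul] at hSa haS
      set d := ∏ l ∈ S, (F.entry l).1 with hd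
      have hdn : d ∣ n := h.prod_dvd (hsub S hS2)
      have hd0 : (0 : ℝ) < d := by
        exact_mod_cast Nat.pos_of_dvd_of_pos hdn (Nat.pos_of_ne_zero h.ne_zero)
      have hP0 : (0 : ℝ) < ((∏ l ∈ range (i + 1), (F.entry l).1 : ℕ) : ℝ) := by
        exact_mod_cast prod_pos fun l hl => hpos l (by have := mem_range.1 hl; omega)
      refine mem_coe.2 (mem_filter.2 ⟨Nat.mem_divisors.2 ⟨hdn, h.ne_zero⟩, ?_, hSa.trans haA', ?_⟩)
      · intro q hq hqd
        obtain ⟨l, hl, rfl⟩ := h.exists_eq_of_dvd_prod (hsub S hS2) hq hqd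
        have := mem_Ico.1 (hS2 hl)
        exact h.increasing i hi' l this.2 (by omega)
      · have h3 : A ≤ d * ((∏ l ∈ range (i + 1), (F.entry l).1 : ℕ) : ℝ) := by
          rw [← Nat.cast_mul]
          exact haA.trans haS.le
        have h4 := log_le_log (by linarith) h3
        rw [log_mul hd0.ne' hP0.ne'] at h4
        have h5 := h.log_prod_le_smoothLog hi'
        rw [log_div (by positivity) hd0.ne', log_mul (by norm_num) (by positivity)]
        linarith
    · refine h.prod_injOn.mono fun S hS => ?_
      exact mem_coe.2 (mem_powerset.2
        (hsub S (mem_powerset.1 (mem_filter.1 (mem_coe.1 hS)).1)))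
  have h3 : (factToSumMu F a).time ≤ 6 * F.len + 5 + (6 + 17 *
      ∑ i ∈ range F.len, #(criticalDivisors (2 * A) n (F.entry i).1)) := by
    rw [factToSumMu_time]
    refine Nat.add_le_add_left (h1.trans ?_) _
    omega
  rw [factToSumMu_time] at h3
  have h4 : ((6 * F.len + 5 + (subFactSum F F.len 1 1 a (∏ i ∈ range F.len, (F.entry i).1)).time
      : ℕ) : ℝ) ≤ ((6 * F.len + 5 + (6 + 17 *
      ∑ i ∈ range F.len, #(criticalDivisors (2 * A) n (F.entry i).1)) : ℕ) : ℝ) := by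
    exact_mod_cast h3
  refine h4.trans (le_of_eq ?_)
  push_cast
  ring

end FactorArray.IsFactorizationOf

/-! ### Correctness and average running time -/

theorem proposition3p2 :
    (∀ (n : ℕ) (F : FactorArray) (a : ℝ), F.IsFactorizationOf n →
      (factToSumMu F a).val = divisorMuSum n a) ∧
    ∃ C : ℝ, 0 < C ∧
      ∀ (N : ℕ) (A : ℝ), 3 ≤ N → 1 ≤ A →
        ∀ (a : ℕ → ℝ) (F : ℕ → FactorArray),
          (∀ n ∈ Finset.Ioc N (2 * N), A ≤ a n ∧ a n ≤ 2 * A) →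
          (∀ n ∈ Finset.Ioc N (2 * N), (F n).IsFactorizationOf n) →
            (∑ n ∈ Finset.Ioc N (2 * N), ((factToSumMu (F n) (a n)).time : ℝ)) / (N : ℝ) ≤
              C * Real.log (Real.log (N : ℝ)) := by
  refine ⟨fun n F a h => ?_, ?_⟩
  · rw [factToSumMu_val, h.divisorMuSum_eq, subFactSum_val F a F.len 1 1 one_pos one_pos
      (fun i hi => (h.prime i hi).pos) (by rw [one_mul, one_mul])]
    simp only [one_mul]
  · obtain ⟨C, hC, hbound⟩ := exists_sum_inv_primesLE_two_mul_le
    refine ⟨500000 * C, by positivity, fun N A hN hA a F ha hF => ?_⟩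
    obtain ⟨h1, h2⟩ := hbound N hN
    have hN0 : (0 : ℝ) < N := by exact_mod_cast (by omega : 0 < N)
    set P := ∑ p ∈ Nat.primesLE (2 * N), (1 / p : ℝ)
    set ll := log (log (N : ℝ))
    have hsub : Ioc N (2 * N) ⊆ Icc 1 (2 * N) := fun n hn => by
      rw [mem_Ioc] at hn
      exact mem_Icc.2 ⟨by omega, hn.2⟩
    have hcrit := sum_card_criticalDivisors_le (X := 2 * A) (by linarith) (2 * N)
    have homega := sum_card_primeFactors_le (2 * N)
    push_cast at hcrit homega
    have hsum : ∑ n ∈ Ioc N (2 * N), ((factToSumMu (F n) (a n)).time : ℝ)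
        ≤ 11 * N + 6 * (2 * N * P) + 17 * (13201 * (2 * N) * P) := by
      calc _ ≤ ∑ n ∈ Ioc N (2 * N), (11 + 6 * (#n.primeFactors : ℝ)
            + 17 * ∑ p ∈ n.primeFactors, (#(criticalDivisors (2 * A) n p) : ℝ)) :=
            sum_le_sum fun n hn =>
              (hF n hn).factToSumMu_time_le hA (ha n hn).1 (ha n hn).2
        _ = 11 * N + 6 * ∑ n ∈ Ioc N (2 * N), (#n.primeFactors : ℝ)
            + 17 * ∑ n ∈ Ioc N (2 * N), ∑ p ∈ n.primeFactors,
              (#(criticalDivisors (2 * A) n p) : ℝ) := by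
            rw [sum_add_distrib, sum_add_distrib, ← mul_sum, ← mul_sum, sum_const, Nat.card_Ioc,
              show 2 * N - N = N by omega, nsmul_eq_mul]
            ring
        _ ≤ _ := by
            gcongr
            · exact (sum_le_sum_of_subset_of_nonneg hsub fun _ _ _ => by positivity).trans homega
            · exact (sum_le_sum_of_subset_of_nonneg hsub fun _ _ _ => by positivity).trans hcrit
    rw [div_le_iff₀ hN0]
    have hN1 : (N : ℝ) ≤ N * (C * ll) := le_mul_of_one_le_right hN0.le h1
    calc _ ≤ _ := hsum
      _ ≤ 11 * (N * (C * ll)) + 6 * (2 * N * (C * ll)) + 17 * (13201 * (2 * N) * (C * ll)) := by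
          gcongr
      _ ≤ 500000 * C * ll * N := by
          have : 0 ≤ C * ll * N := mul_nonneg (by linarith) hN0.le
          linarith
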